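/- Let $\mathbb K$ be a field, $d\ge 0$ an integer, and $\mathcal A$ a $\mathbb K$-algebra isomorphic to $\mathrm{Mat}_{d+1}(\mathbb K)$ (matrices indexed by $0,\dots,d$). Let $V$ be a simple $\mathcal A$-module, and write $\mathrm{tr}(X)$ for the trace of the action of $X\in\mathcal A$ on $V$. Let $\Phi=(A;\{E_i\}_{i=0}^d;A^*;\{E_i^*\}_{i=0}^d)$ be a Leonard system in $\mathcal A$. That is: each of $A,A^*\in\mathcal A$ has $d+1$ mutually distinct eigenvalues in $\mathbb K$; $E_0,\dots,E_d$ (resp. $E^*_0,\dots,E^*_d$) is an ordering of the primitive idempotents of $A$ (resp. $A^*$), so that $$E_i=\prod_{j\ne i}\frac{A-\theta_jI}{\theta_i-\theta_j},\qquad E^*_i=\prod_{j\ne i}\frac{A^*-\theta^*_jI}{\theta^*_i-\theta^*_j},$$ where $\theta_i$ (resp. $\theta_i^*$) is the eigenvalue of $A$ (resp. $A^*$) associated with $E_i$ (resp. $E_i^*$); and, for $0\le i,j\le d$, the elements $E_iA^*E_j$ and $E_i^*AE_j^*$ are both zero if $|i-j|>1$ and both nonzero if $|i-j|=1$. For $0\le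 i\le d$ put $$U_i=(E_0^*V+\cdots+E_i^*V)\cap(E_iV+\cdots+E_dV),$$ $$\tau_i=\prod_{k=0}^{i-1}(\lambda-\theta_k),\quad \tau_i^*=\prod_{k=0}^{i-1}(\lambda-\theta_k^*),\quad \eta_i=\prod_{k=0}^{i-1}(\lambda-\theta_{d-k}),\quad \eta_i^*=\prod_{k=0}^{i-1}(\lambda-\theta^*_{d-k}).$$ For $1\le i\le d$ let $\varphi_i$ be the eigenvalue of $(A-\theta_{i-1}I)(A^*-\theta_i^*I)$ on $U_i$. Let $\nu=\mathrm{tr}(E_0^*E_0)^{-1}$, and let $\nu^{\downarrow\Downarrow}=\mathrm{tr}(E_d^*E_d)^{-1}$ be the corresponding scalar for the Leonard system $(A;\{E_{d-i}\}_{i=0}^d;A^*;\{E^*_{d-i}\}_{i=0}^d)$. A $\Phi$-split basis is a sequence of nonzero vectors $u_i\in U_i$ $(0\le i\le d)$ with $(A-\theta_iI)u_i=u_{i+1}$ for $0\le i\le d-1$. Theorem. A $\Phi$-split basis exists, and every $\Phi$-split basis $u_0,\dots,u_d$ is a basis of $V$. For $0\le i,j\le d$ there is a unique $\Delta_{i,j}\in\mathcal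 A$ that is represented with respect to $u_0,\dots,u_d$ by the matrix with $(i,j)$-entry $1$ and all other entries $0$, and $$\Delta_{i,j}=\frac{\nu\,\tau_i(A)\,E_0^*E_0\,\tau_j^*(A^*)}{\varphi_1\varphi_2\cdots\varphi_j}=\frac{\nu^{\downarrow\Downarrow}\,\eta^*_{d-i}(A^*)\,E_dE_d^*\,\eta_{d-j}(A)}{\varphi_d\varphi_{d-1}\cdots\varphi_{i+1}}.$$ -/

import Mathlib

open Polynomial

/-- `E` is an ordering of the primitive idempotents of `a`, the eigenvalue belonging to `E i` being
`θ i`: the scalars `θ 0, …, θ d` are mutually distinct and are precisely the eigenvalues of `a`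
(in an algebra isomorphic to the full matrix algebra, the spectrum is the set of eigenvalues), and
`E i = ∏_{j ≠ i} (a - θ j) / (θ i - θ j)`. -/
def IsIdempotentOrdering {K 𝒜 : Type*} [Field K] [Ring 𝒜] [Algebra K 𝒜] {d : ℕ}
    (a : 𝒜) (E : Fin (d + 1) → 𝒜) (θ : Fin (d + 1) → K) : Prop :=
  Function.Injective θ ∧ Set.range θ = spectrum K a ∧
    ∀ i, E i = aeval a (∏ j ∈ Finset.univ.erase i, (C ((θ i - θ j)⁻¹) * (X - C (θ j))))

theorem IsIdempotentOrdering.rev {K 𝒜 : Type*} [Field K] [Ring 𝒜] [Algebra K 𝒜] {d : ℕ}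
    {a : 𝒜} {E : Fin (d + 1) → 𝒜} {θ : Fin (d + 1) → K} (h : IsIdempotentOrdering a E θ) :
    IsIdempotentOrdering a (fun i => E i.rev) (fun i => θ i.rev) := by
  obtain ⟨h1, h2, h3⟩ := h
  refine ⟨h1.comp Fin.rev_injective, ?_, fun i => ?_⟩
  · rw [← h2]
    exact Fin.rev_surjective.range_comp θ
  · refine (h3 i.rev).trans ?_
    congr 1
    symm
    refine Finset.prod_bij (fun j _ => j.rev) ?_ ?_ ?_ ?_
    · intro j hj
      simpa using hj
    · intro j _ k _ hjk
      exact Fin.rev_injective hjk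
    · intro j hj
      refine ⟨j.rev, ?_, by simp⟩
      simp only [Finset.mem_erase, Finset.mem_univ, and_true] at hj ⊢
      intro h
      exact hj (by rw [← h, Fin.rev_rev])
    · intro j _
      rfl

/-- A Leonard system `(A; {E_i}; A*; {E*_i})` of diameter `d` in the `K`-algebra `𝒜`, which in the
applications is isomorphic to the algebra of `(d + 1) × (d + 1)` matrices. The fields `hE`, `hEs`
say that `A`, `A*` have `d + 1` mutually distinct eigenvalues in `K` (multiplicity-freeness) and
that the `E_i`, `E*_i` are orderings of their primitive idempotents. -/
structure LeonardSystem (K 𝒜 : Type*) [Field K] [Ring 𝒜] [Algebra K 𝒜] (d : ℕ) where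
  A : 𝒜
  E : Fin (d + 1) → 𝒜
  As : 𝒜
  Es : Fin (d + 1) → 𝒜
  hE : ∃ θ : Fin (d + 1) → K, IsIdempotentOrdering A E θ
  hEs : ∃ θ : Fin (d + 1) → K, IsIdempotentOrdering As Es θ
  E_As_E_eq_zero : ∀ i j : Fin (d + 1), 1 < |(i : ℤ) - (j : ℤ)| → E i * As * E j = 0
  E_As_E_ne_zero : ∀ i j : Fin (d + 1), |(i : ℤ) - (j : ℤ)| = 1 → E i * As * E j ≠ 0
  Es_A_Es_eq_zero : ∀ i j : Fin (d + 1), 1 < |(i : ℤ) - (j : ℤ)| → Es i * A * Es j = 0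
  Es_A_Es_ne_zero : ∀ i j : Fin (d + 1), |(i : ℤ) - (j : ℤ)| = 1 → Es i * A * Es j ≠ 0

theorem abs_fin_rev_sub_rev {d : ℕ} (i j : Fin (d + 1)) :
    |((i.rev : Fin (d + 1)) : ℤ) - ((j.rev : Fin (d + 1)) : ℤ)| = |(i : ℤ) - (j : ℤ)| := by
  have hi : ((i.rev : Fin (d + 1)) : ℤ) = d - i := by
    have := i.isLt
    rw [Fin.val_rev]
    omega
  have hj : ((j.rev : Fin (d + 1)) : ℤ) = d - j := by
    have := j.isLt
    rw [Fin.val_rev]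
    omega
  rw [hi, hj, abs_sub_comm (i : ℤ)]
  congr 1
  ring

/-- `Y` represents `x` with respect to the vectors `v_0, …, v_d`: `x v_j = ∑ i, Y_{ij} v_i`. -/
def Represents {K 𝒜 V : Type*} [Field K] [Ring 𝒜] [AddCommGroup V] [Module K V] [Module 𝒜 V]
    {d : ℕ} (Y : Matrix (Fin (d + 1)) (Fin (d + 1)) K) (x : 𝒜) (v : Fin (d + 1) → V) : Prop :=
  ∀ j, x • v j = ∑ i, Y i j • v i

/-- `τ_i = (X - θ_0)(X - θ_1) ⋯ (X - θ_{i-1})`. -/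
noncomputable def tauPoly {K : Type*} [Field K] {d : ℕ} (θ : Fin (d + 1) → K)
    (i : Fin (d + 1)) : K[X] :=
  ∏ k ∈ Finset.Iio i, (X - C (θ k))

/-- `η_i = (X - θ_d)(X - θ_{d-1}) ⋯ (X - θ_{d-i+1})`; recall that `k.rev` is `d - k`. -/
noncomputable def etaPoly {K : Type*} [Field K] {d : ℕ} (θ : Fin (d + 1) → K)
    (i : Fin (d + 1)) : K[X] :=
  ∏ k ∈ Finset.Iio i, (X - C (θ k.rev))

namespace LeonardSystem

section System

variable {K 𝒜 : Type*} [Field K] [Ring 𝒜] [Algebra K 𝒜] {d : ℕ}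

/-- The relative `Φ^↓ = (A; {E_i}; A*; {E*_{d-i}})`. -/
def down (Φ : LeonardSystem K 𝒜 d) : LeonardSystem K 𝒜 d where
  A := Φ.A
  E := Φ.E
  As := Φ.As
  Es := fun i => Φ.Es i.rev
  hE := Φ.hE
  hEs := let ⟨_, h⟩ := Φ.hEs; ⟨_, h.rev⟩
  E_As_E_eq_zero := Φ.E_As_E_eq_zero
  E_As_E_ne_zero := Φ.E_As_E_ne_zero
  Es_A_Es_eq_zero := fun i j h => Φ.Es_A_Es_eq_zero _ _ (by rwa [abs_fin_rev_sub_rev])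
  Es_A_Es_ne_zero := fun i j h => Φ.Es_A_Es_ne_zero _ _ (by rwa [abs_fin_rev_sub_rev])

/-- The relative `Φ^⇓ = (A; {E_{d-i}}; A*; {E*_i})`. -/
def ddown (Φ : LeonardSystem K 𝒜 d) : LeonardSystem K 𝒜 d where
  A := Φ.A
  E := fun i => Φ.E i.rev
  As := Φ.As
  Es := Φ.Es
  hE := let ⟨_, h⟩ := Φ.hE; ⟨_, h.rev⟩
  hEs := Φ.hEs
  E_As_E_eq_zero := fun i j h => Φ.E_As_E_eq_zero _ _ (by rwa [abs_fin_rev_sub_rev])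
  E_As_E_ne_zero := fun i j h => Φ.E_As_E_ne_zero _ _ (by rwa [abs_fin_rev_sub_rev])
  Es_A_Es_eq_zero := Φ.Es_A_Es_eq_zero
  Es_A_Es_ne_zero := Φ.Es_A_Es_ne_zero

/-- The eigenvalue sequence: `θ_i` is the eigenvalue of `A` associated with `E_i`
(the only scalar with `A E_i = θ_i E_i`). -/
noncomputable def theta (Φ : LeonardSystem K 𝒜 d) : Fin (d + 1) → K := Φ.hE.choose

/-- The dual eigenvalue sequence: `θ*_i` is the eigenvalue of `A*` associated with `E*_i`. -/
noncomputable def thetas (Φ : LeonardSystem K 𝒜 d) : Fin (d + 1) → K := Φ.hEs.choose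

end System

section Modules

variable {K 𝒜 : Type*} [Field K] [Ring 𝒜] [Algebra K 𝒜] {d : ℕ}
  (Φ : LeonardSystem K 𝒜 d)
  (V : Type*) [AddCommGroup V] [Module K V] [Module 𝒜 V] [IsScalarTower K 𝒜 V]

/-- The component `U_i = (E*_0 V + ⋯ + E*_i V) ∩ (E_i V + ⋯ + E_d V)` of the `Φ`-split
decomposition of `V`. -/
noncomputable def splitSpace (i : Fin (d + 1)) : Submodule K V :=
  (⨆ j ∈ Finset.Iic i, LinearMap.range (Algebra.lsmul K K V (Φ.Es j))) ⊓
    (⨆ j ∈ Finset.Ici i, LinearMap.range (Algebra.lsmul K K V (Φ.E j)))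

/-- The first split sequence, indexed from zero: `Φ.firstSplit V k` is `φ_{k+1}`, the eigenvalue of
`(A - θ_k)(A* - θ*_{k+1})` on the one-dimensional space `U_{k+1}`, for `0 ≤ k ≤ d - 1`. -/
noncomputable def firstSplit (k : Fin d) : K :=
  Classical.epsilon fun c : K =>
    Φ.splitSpace V k.succ ≤ Module.End.eigenspace
      (Algebra.lsmul K K V ((Φ.A - algebraMap K 𝒜 (Φ.theta k.castSucc)) *
        (Φ.As - algebraMap K 𝒜 (Φ.thetas k.succ)))) c

/-- The scalar `ν = tr(E*_0 E_0)⁻¹`. The trace of an element of `𝒜` is the trace of its action on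
the simple module `V`, which is the matrix trace under any isomorphism of `𝒜` with a full matrix
algebra. -/
noncomputable def nu : K :=
  (LinearMap.trace K V (Algebra.lsmul K K V (Φ.Es 0 * Φ.E 0)))⁻¹

variable {V} in
/-- `u_0, …, u_d` is a `Φ`-split basis of `V`: nonzero vectors `u_i ∈ U_i` with
`(A - θ_i) u_i = u_{i+1}` for `0 ≤ i ≤ d - 1`. (That `(A - θ_d) u_d = 0` is automatic, because
`U_d` lies in `E_d V`.) -/
structure IsSplitBasis (u : Fin (d + 1) → V) : Prop where
  mem : ∀ i, u i ∈ Φ.splitSpace V i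
  ne_zero : ∀ i, u i ≠ 0
  raise : ∀ k : Fin d,
    (Φ.A - algebraMap K 𝒜 (Φ.theta k.castSucc)) • u k.castSucc = u k.succ

end Modules

end LeonardSystem

section Tridiagonal

variable {K V : Type*} [Field K] [AddCommGroup V] [Module K V] {d : ℕ}

/-- The matrix of `T` in the basis `b` is irreducible tridiagonal. -/
def IsIrreducibleTridiagonal (b : Module.Basis (Fin (d + 1)) K V) (T : Module.End K V) : Prop :=
  (∀ i j : Fin (d + 1), 1 < |(i : ℤ) - (j : ℤ)| → b.repr (T (b j)) i = 0) ∧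
    ∀ i j : Fin (d + 1), |(i : ℤ) - (j : ℤ)| = 1 → b.repr (T (b j)) i ≠ 0

theorem Module.Basis.repr_end_apply {ι : Type*} [Fintype ι] (b : Module.Basis ι K V)
    (T : Module.End K V) (x : V) (i : ι) :
    b.repr (T x) i = ∑ j, b.repr x j * b.repr (T (b j)) i := by
  conv_lhs => rw [← b.sum_repr x, map_sum, map_sum]
  simp [Finsupp.finsetSum_apply]

theorem Module.Basis.repr_apply_of_eigen {ι : Type*} [Fintype ι] {b : Module.Basis ι K V}
    {T : Module.End K V} {θ : ι → K} (h : ∀ i, T (b i) = θ i • b i) (x : V) (i : ι) :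
    b.repr (T x) i = θ i * b.repr x i := by
  classical
  rw [b.repr_end_apply, Finset.sum_eq_single i]
  · simp [h, mul_comm]
  · intro j _ hj
    simp [h, hj]
  · simp

theorem Module.Basis.repr_aeval_of_eigen {ι : Type*} [Fintype ι] {b : Module.Basis ι K V}
    {T : Module.End K V} {θ : ι → K} (h : ∀ i, T (b i) = θ i • b i) (p : K[X]) (x : V) (i : ι) :
    b.repr (aeval T p x) i = p.eval (θ i) * b.repr x i := by
  induction p using Polynomial.induction_on' generalizing x with
  | add p q hp hq => simp [hp, hq, add_mul]
  | monomial n a =>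
    have : ∀ n : ℕ, b.repr ((T ^ n) x) i = θ i ^ n * b.repr x i := by
      intro n
      induction n with
      | zero => simp
      | succ n ih => rw [pow_succ', Module.End.mul_apply, repr_apply_of_eigen h, ih]; ring
    simp [aeval_monomial, this, mul_assoc, Algebra.algebraMap_eq_smul_one]

theorem IsIrreducibleTridiagonal.reindex_rev {b : Module.Basis (Fin (d + 1)) K V}
    {T : Module.End K V} (h : IsIrreducibleTridiagonal b T) :
    IsIrreducibleTridiagonal (b.reindex Fin.revPerm) T := by
  refine ⟨fun i j hij => ?_, fun i j hij => ?_⟩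
  · simpa using h.1 i.rev j.rev (by rwa [abs_fin_rev_sub_rev])
  · simpa using h.2 i.rev j.rev (by rwa [abs_fin_rev_sub_rev])

/-- An eigenvector of an irreducible tridiagonal matrix has nonzero first coordinate. -/
theorem IsIrreducibleTridiagonal.repr_zero_ne_zero {b : Module.Basis (Fin (d + 1)) K V}
    {T : Module.End K V} (h : IsIrreducibleTridiagonal b T) {x : V} (hx : x ≠ 0) {c : K}
    (hT : T x = c • x) : b.repr x 0 ≠ 0 := by
  intro h0
  apply hx
  have key : ∀ n : ℕ, ∀ k : Fin (d + 1), (k : ℕ) ≤ n → b.repr x k = 0 := by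
    intro n
    induction n with
    | zero =>
      intro k hk
      have : k = 0 := Fin.ext (by simpa using hk)
      rw [this, h0]
    | succ n ih =>
      intro k hk
      by_cases hkn : (k : ℕ) ≤ n
      · exact ih k hkn
      have hk' : (k : ℕ) = n + 1 := by omega
      have hlt := k.isLt
      let m : Fin (d + 1) := ⟨n, by omega⟩
      have e := b.repr_end_apply T x m
      rw [hT, Finset.sum_eq_single k] at e
      · have hm : b.repr x m = 0 := ih m le_rfl
        rw [map_smul, Finsupp.smul_apply, hm, smul_zero] at e
        refine (mul_eq_zero.1 e.symm).resolve_right (h.2 m k ?_)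
        have : ((m : Fin (d + 1)) : ℤ) - (k : ℤ) = -1 := by
          simp only [m, hk']; push_cast; ring
        rw [this]; rfl
      · intro j _ hj
        by_cases hjn : (j : ℕ) ≤ n
        · rw [ih j hjn, zero_mul]
        · rw [h.1 m j, mul_zero]
          have : (j : ℕ) ≠ k := fun h => hj (Fin.ext h)
          rw [abs_sub_comm, lt_abs]
          left
          simp only [m]
          omega
      · simp
  exact b.repr.map_eq_zero_iff.1 (Finsupp.ext fun k => key d k (by omega))

theorem IsIrreducibleTridiagonal.repr_last_ne_zero {b : Module.Basis (Fin (d + 1)) K V}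
    {T : Module.End K V} (h : IsIrreducibleTridiagonal b T) {x : V} (hx : x ≠ 0) {c : K}
    (hT : T x = c • x) : b.repr x (Fin.last d) ≠ 0 := by
  simpa using h.reindex_rev.repr_zero_ne_zero hx hT

/-- Triangularity transfers vanishing of the functionals to vanishing of coefficients. -/
theorem coeff_eq_zero_of_triangular {ι : Type*} [Fintype ι] [LinearOrder ι] {f : ι → V →ₗ[K] K}
    {u : ι → V} (h0 : ∀ k l, l < k → f k (u l) = 0) (h1 : ∀ k, f k (u k) ≠ 0) (c : ι → K)
    {S : Set ι} (hS : IsUpperSet S) (hx : ∀ k ∈ S, f k (∑ l, c l • u l) = 0) :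
    ∀ k ∈ S, c k = 0 := by
  intro k
  induction k using WellFoundedGT.induction with
  | ind k ih =>
    intro hk
    have e := hx k hk
    rw [map_sum, Finset.sum_eq_single k] at e
    · simpa [h1 k] using e
    · intro l _ hl
      rcases lt_or_gt_of_ne hl with hl | hl
      · simp [h0 k l hl]
      · simp [ih l hl (hS hl.le hk)]
    · simp

theorem linearIndependent_of_triangular {ι : Type*} [Fintype ι] [LinearOrder ι]
    {f : ι → V →ₗ[K] K} {u : ι → V} (h0 : ∀ k l, l < k → f k (u l) = 0)
    (h1 : ∀ k, f k (u k) ≠ 0) : LinearIndependent K u := by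
  rw [Fintype.linearIndependent_iff]
  intro c hc k
  exact coeff_eq_zero_of_triangular h0 h1 c isUpperSet_univ (fun k _ => by rw [hc, map_zero]) k
    (Set.mem_univ k)

theorem tauPoly_zero (θ : Fin (d + 1) → K) : tauPoly θ 0 = 1 := by
  have : Finset.Iio (0 : Fin (d + 1)) = ∅ := by ext; simp
  rw [tauPoly, this, Finset.prod_empty]

theorem tauPoly_succ (θ : Fin (d + 1) → K) (k : Fin d) :
    tauPoly θ k.succ = tauPoly θ k.castSucc * (X - C (θ k.castSucc)) := by
  have : Finset.Iio k.succ = insert k.castSucc (Finset.Iio k.castSucc) := by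
    ext j
    simp only [Finset.mem_Iio, Finset.mem_insert, Fin.lt_def, Fin.ext_iff, Fin.val_succ,
      Fin.val_castSucc]
    omega
  rw [tauPoly, this, Finset.prod_insert (by simp), mul_comm, tauPoly]

theorem etaPoly_eq_tauPoly (θ : Fin (d + 1) → K) : etaPoly θ = tauPoly fun k => θ k.rev := rfl

theorem prod_castSucc_lt_succ (φ : Fin d → K) (j : Fin d) :
    ∏ k : Fin d with k.castSucc < j.succ, φ k =
      (∏ k : Fin d with k.castSucc < j.castSucc, φ k) * φ j := by
  have : Finset.univ.filter (fun k : Fin d => k.castSucc < j.succ) =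
      insert j (Finset.univ.filter fun k : Fin d => k.castSucc < j.castSucc) := by
    ext k
    simp only [Finset.mem_filter, Finset.mem_univ, true_and, Finset.mem_insert, Fin.lt_def,
      Fin.ext_iff, Fin.val_succ, Fin.val_castSucc]
    omega
  rw [this, Finset.prod_insert (by simp), mul_comm]

theorem aeval_tauPoly_apply_zero {T : Module.End K V} {θ : Fin (d + 1) → K} {u : Fin (d + 1) → V}
    {ψ : Fin d → K} (hT : ∀ k : Fin d, T (u k.castSucc) =
      θ k.castSucc • u k.castSucc + ψ k • u k.succ) (i : Fin (d + 1)) :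
    aeval T (tauPoly θ i) (u 0) = (∏ k : Fin d with k.castSucc < i, ψ k) • u i := by
  induction i using Fin.induction with
  | zero => simp [tauPoly_zero]
  | succ i ih =>
    rw [tauPoly_succ, mul_comm, map_mul, Module.End.mul_apply, ih, prod_castSucc_lt_succ, map_smul,
      mul_smul]
    simp [hT]

theorem functional_aeval_tauPoly {T : Module.End K V} {θ : Fin (d + 1) → K}
    {u : Fin (d + 1) → V} {φ : Fin d → K} (hT0 : T (u 0) = θ 0 • u 0)
    (hT : ∀ k : Fin d, T (u k.succ) = θ k.succ • u k.succ + φ k • u k.castSucc)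
    {f : V →ₗ[K] K} (hf : ∀ k, k ≠ 0 → f (u k) = 0) (j k : Fin (d + 1)) :
    f (aeval T (tauPoly θ j) (u k)) =
      if k = j then (∏ k : Fin d with k.castSucc < j, φ k) * f (u 0) else 0 := by
  induction j using Fin.induction generalizing k with
  | zero =>
    split_ifs with h
    · simp [h, tauPoly_zero]
    · simp [tauPoly_zero, hf k h]
  | succ j ih =>
    rw [tauPoly_succ, map_mul, Module.End.mul_apply]
    refine Fin.cases ?_ (fun k => ?_) k
    · have : aeval T (X - C (θ j.castSucc)) (u 0) = (θ 0 - θ j.castSucc) • u 0 := by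
        simp [hT0, sub_smul]
      rw [this, map_smul, map_smul, ih, if_neg (Fin.succ_ne_zero j).symm]
      split_ifs with h
      · simp [← h]
      · simp
    · have : aeval T (X - C (θ j.castSucc)) (u k.succ) =
          (θ k.succ - θ j.castSucc) • u k.succ + φ k • u k.castSucc := by
        simp [hT, sub_smul]; abel
      rw [this, map_add, map_add, map_smul, map_smul, map_smul, map_smul, ih, ih]
      have e1 : (θ k.succ - θ j.castSucc) • (if k.succ = j.castSucc then
          (∏ k : Fin d with k.castSucc < j.castSucc, φ k) * f (u 0) else 0) = 0 := by
        split_ifs with h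
        · simp [h]
        · simp
      rw [e1, zero_add]
      by_cases h : k = j
      · subst h
        rw [if_pos rfl, if_pos rfl, prod_castSucc_lt_succ, smul_eq_mul]; ring
      · rw [if_neg (by simpa using h), if_neg (by simpa using h), smul_zero]

end Tridiagonal

section Chain

variable {K V : Type*} [Field K] [AddCommGroup V] [Module K V] {d : ℕ}

/-- Eigenbases `w` of `A` and `ws` of `As`, each of the two maps being irreducible tridiagonal in
the eigenbasis of the other one. -/
structure IsLeonardEigenbases (A As : Module.End K V) (θ θs : Fin (d + 1) → K)
    (w ws : Module.Basis (Fin (d + 1)) K V) : Prop where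
  inj : Function.Injective θ
  injs : Function.Injective θs
  eigen : ∀ i, A (w i) = θ i • w i
  eigens : ∀ i, As (ws i) = θs i • ws i
  tri : IsIrreducibleTridiagonal w As
  tris : IsIrreducibleTridiagonal ws A

/-- `u` is obtained from an eigenvector `u 0` of `As` by repeatedly applying the maps `A - θ k`. -/
structure IsSplitChain (A As : Module.End K V) (θ θs : Fin (d + 1) → K) (u : Fin (d + 1) → V) :
    Prop where
  ne_zero : u 0 ≠ 0
  eigen : As (u 0) = θs 0 • u 0
  raise : ∀ k : Fin d, A (u k.castSucc) = θ k.castSucc • u k.castSucc + u k.succ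

namespace IsSplitChain

variable {A As : Module.End K V} {θ θs : Fin (d + 1) → K}
  {w ws : Module.Basis (Fin (d + 1)) K V} {u : Fin (d + 1) → V}

theorem raise_eq_sub (hu : IsSplitChain A As θ θs u) (k : Fin d) :
    u k.succ = A (u k.castSucc) - θ k.castSucc • u k.castSucc := by
  rw [hu.raise, add_sub_cancel_left]

theorem reprs_zero_of_ne (h : IsLeonardEigenbases A As θ θs w ws) (hu : IsSplitChain A As θ θs u)
    {k : Fin (d + 1)} (hk : k ≠ 0) : ws.repr (u 0) k = 0 := by
  have e := Module.Basis.repr_apply_of_eigen h.eigens (u 0) k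
  rw [hu.eigen, map_smul, Finsupp.smul_apply, smul_eq_mul, ← sub_eq_zero, ← sub_mul] at e
  exact (mul_eq_zero.1 e).resolve_left (sub_ne_zero.2 fun e => hk (h.injs e).symm)

theorem reprs_zero_ne_zero (h : IsLeonardEigenbases A As θ θs w ws)
    (hu : IsSplitChain A As θ θs u) : ws.repr (u 0) 0 ≠ 0 := by
  intro h0
  refine hu.ne_zero (ws.repr.map_eq_zero_iff.1 (Finsupp.ext fun k => ?_))
  by_cases hk : k = 0
  · rw [hk, h0]; rfl
  · exact hu.reprs_zero_of_ne h hk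

theorem reprs_triangular (h : IsLeonardEigenbases A As θ θs w ws) (hu : IsSplitChain A As θ θs u)
    (i : Fin (d + 1)) : (∀ k, i < k → ws.repr (u i) k = 0) ∧ ws.repr (u i) i ≠ 0 := by
  induction i using Fin.induction with
  | zero => exact ⟨fun k hk => hu.reprs_zero_of_ne h hk.ne', hu.reprs_zero_ne_zero h⟩
  | succ i ih =>
    obtain ⟨ih0, ih1⟩ := ih
    have e : ∀ k, i.castSucc < k → ws.repr (u i.succ) k =
        ∑ j, ws.repr (u i.castSucc) j * ws.repr (A (ws j)) k := by
      intro k hk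
      rw [hu.raise_eq_sub, map_sub, map_smul, Finsupp.sub_apply, Finsupp.smul_apply, ih0 k hk,
        smul_zero, sub_zero, ws.repr_end_apply]
    constructor
    · intro k hk
      rw [e k (lt_trans Fin.castSucc_lt_succ hk)]
      refine Finset.sum_eq_zero fun j _ => ?_
      rcases le_or_gt j i.castSucc with hj | hj
      · rw [h.tris.1, mul_zero]
        rw [lt_abs]; left
        simp only [Fin.lt_def, Fin.le_def, Fin.val_succ, Fin.val_castSucc] at hk hj
        omega
      · rw [ih0 j hj, zero_mul]
    · rw [e _ Fin.castSucc_lt_succ, Finset.sum_eq_single i.castSucc]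
      · refine mul_ne_zero ih1 (h.tris.2 _ _ ?_)
        simp
      · intro j _ hj
        rcases lt_or_gt_of_ne hj with hj | hj
        · rw [h.tris.1, mul_zero]
          rw [lt_abs]; left
          simp only [Fin.lt_def, Fin.val_succ, Fin.val_castSucc] at hj ⊢
          omega
        · rw [ih0 j hj, zero_mul]
      · simp

theorem linearIndependent (h : IsLeonardEigenbases A As θ θs w ws)
    (hu : IsSplitChain A As θ θs u) : LinearIndependent K u :=
  linearIndependent_of_triangular (f := ws.coord)
    (fun k l hl => by simpa using (hu.reprs_triangular h l).1 k hl)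
    fun k => by simpa using (hu.reprs_triangular h k).2

theorem span_eq_top (h : IsLeonardEigenbases A As θ θs w ws)
    (hu : IsSplitChain A As θ θs u) : Submodule.span K (Set.range u) = ⊤ :=
  have := w.finiteDimensional_of_finite
  (hu.linearIndependent h).span_eq_top_of_card_eq_finrank' (Module.finrank_eq_card_basis w).symm

theorem repr_succ (h : IsLeonardEigenbases A As θ θs w ws) (hu : IsSplitChain A As θ θs u)
    (i : Fin d) (k : Fin (d + 1)) :
    w.repr (u i.succ) k = (θ k - θ i.castSucc) * w.repr (u i.castSucc) k := by
  rw [hu.raise_eq_sub, map_sub, map_smul, Finsupp.sub_apply, Finsupp.smul_apply,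
    Module.Basis.repr_apply_of_eigen h.eigen, smul_eq_mul, sub_mul]

theorem repr_zero_ne_zero (h : IsLeonardEigenbases A As θ θs w ws)
    (hu : IsSplitChain A As θ θs u) (k : Fin (d + 1)) : w.repr (u 0) k ≠ 0 := by
  intro h0
  have key : ∀ i, w.coord k (u i) = 0 := by
    intro i
    induction i using Fin.induction with
    | zero => simpa using h0
    | succ i ih => simpa [hu.repr_succ h] using Or.inr ih
  have : w.coord k = 0 := LinearMap.ext_on_range (hu.span_eq_top h) (by simpa using key)
  simpa using congrArg (fun f => f (w k)) this

theorem repr_triangular (h : IsLeonardEigenbases A As θ θs w ws) (hu : IsSplitChain A As θ θs u)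
    (i : Fin (d + 1)) : (∀ k, k < i → w.repr (u i) k = 0) ∧ ∀ k, i ≤ k → w.repr (u i) k ≠ 0 := by
  induction i using Fin.induction with
  | zero => exact ⟨fun k hk => absurd hk (by simp), fun k _ => hu.repr_zero_ne_zero h k⟩
  | succ i ih =>
    refine ⟨fun k hk => ?_, fun k hk => ?_⟩
    · rw [hu.repr_succ h]
      rcases eq_or_ne k i.castSucc with rfl | hne
      · simp
      · rw [ih.1, mul_zero]
        exact lt_of_le_of_ne (Fin.le_castSucc_iff.2 hk) hne
    · rw [hu.repr_succ h]
      have hk' : i.castSucc < k := Fin.castSucc_lt_succ.trans_le hk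
      exact mul_ne_zero (sub_ne_zero.2 fun e => hk'.ne' (h.inj e)) (ih.2 k hk'.le)

/-- The `i`-th component of the split decomposition is spanned by `u i`. -/
theorem exists_eq_smul (h : IsLeonardEigenbases A As θ θs w ws) (hu : IsSplitChain A As θ θs u)
    {i : Fin (d + 1)} {x : V} (h1 : ∀ k, i < k → ws.repr x k = 0)
    (h2 : ∀ k, k < i → w.repr x k = 0) : ∃ c : K, x = c • u i := by
  have hx : x ∈ Submodule.span K (Set.range u) := by rw [hu.span_eq_top h]; trivial
  obtain ⟨c, rfl⟩ := (Submodule.mem_span_range_iff_exists_fun K).1 hx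
  have c1 : ∀ k ∈ Set.Ioi i, c k = 0 :=
    coeff_eq_zero_of_triangular (f := ws.coord)
      (fun k l hl => by simpa using (hu.reprs_triangular h l).1 k hl)
      (fun k => by simpa using (hu.reprs_triangular h k).2) c (isUpperSet_Ioi i)
      fun k hk => h1 k hk
  have c2 : ∀ k ∈ Set.Iio i, c k = 0 :=
    coeff_eq_zero_of_triangular (ι := (Fin (d + 1))ᵒᵈ)
      (f := fun k => w.coord (OrderDual.ofDual k)) (u := fun k => u (OrderDual.ofDual k))
      (fun k l hl => (hu.repr_triangular h (OrderDual.ofDual l)).1 (OrderDual.ofDual k) hl)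
      (fun k => (hu.repr_triangular h (OrderDual.ofDual k)).2 (OrderDual.ofDual k) le_rfl) c
      (S := OrderDual.ofDual ⁻¹' Set.Iio i) (isLowerSet_Iio i).toDual
      fun k hk => h2 (OrderDual.ofDual k) hk
  refine ⟨c i, Finset.sum_eq_single i (fun k _ hk => ?_) (by simp)⟩
  rcases lt_or_gt_of_ne hk with hk | hk
  · rw [c2 k hk, zero_smul]
  · rw [c1 k hk, zero_smul]

theorem exists_lower (h : IsLeonardEigenbases A As θ θs w ws) (hu : IsSplitChain A As θ θs u)
    (k : Fin d) : ∃ c : K, c ≠ 0 ∧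
      As (u k.succ) = θs k.succ • u k.succ + c • u k.castSucc := by
  obtain ⟨c, hc⟩ := hu.exists_eq_smul h (i := k.castSucc)
      (x := As (u k.succ) - θs k.succ • u k.succ) (by
    intro l hl
    rw [map_sub, map_smul, Finsupp.sub_apply, Finsupp.smul_apply,
      Module.Basis.repr_apply_of_eigen h.eigens, smul_eq_mul, ← sub_mul]
    rcases eq_or_ne l k.succ with rfl | hne
    · simp
    · rw [(hu.reprs_triangular h _).1 l, mul_zero]
      exact lt_of_le_of_ne (Fin.castSucc_lt_iff_succ_le.1 hl) hne.symm) (by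
    intro l hl
    rw [map_sub, map_smul, Finsupp.sub_apply, Finsupp.smul_apply,
      (hu.repr_triangular h _).1 l (hl.trans Fin.castSucc_lt_succ), smul_zero, sub_zero,
      w.repr_end_apply]
    refine Finset.sum_eq_zero fun j _ => ?_
    rcases lt_or_ge j k.succ with hj | hj
    · rw [(hu.repr_triangular h _).1 j hj, zero_mul]
    · rw [h.tri.1, mul_zero]
      rw [abs_sub_comm, lt_abs]; left
      simp only [Fin.lt_def, Fin.le_def, Fin.val_succ, Fin.val_castSucc] at hl hj
      omega)
  have hA : As (u k.succ) = θs k.succ • u k.succ + c • u k.castSucc := by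
    rw [← hc, add_sub_cancel]
  refine ⟨c, ?_, hA⟩
  rintro rfl
  rw [zero_smul, add_zero] at hA
  exact h.tri.repr_zero_ne_zero ((hu.linearIndependent h).ne_zero _) hA
    ((hu.repr_triangular h k.succ).1 0 (Fin.succ_pos k))

theorem apply_last (h : IsLeonardEigenbases A As θ θs w ws) (hu : IsSplitChain A As θ θs u) :
    A (u (Fin.last d)) = θ (Fin.last d) • u (Fin.last d) := by
  refine w.repr.injective (Finsupp.ext fun k => ?_)
  rw [Module.Basis.repr_apply_of_eigen h.eigen, map_smul, Finsupp.smul_apply, smul_eq_mul]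
  rcases eq_or_ne k (Fin.last d) with rfl | hk
  · rfl
  · rw [(hu.repr_triangular h _).1 k (Fin.lt_last_iff_ne_last.2 hk), mul_zero, mul_zero]

end IsSplitChain

theorem exists_isSplitChain {A As : Module.End K V} {θ θs : Fin (d + 1) → K}
    {w ws : Module.Basis (Fin (d + 1)) K V}
    (h : IsLeonardEigenbases A As θ θs w ws) : ∃ u, IsSplitChain A As θ θs u := by
  refine ⟨fun i => aeval A (tauPoly θ i) (ws 0), ?_, ?_, fun k => ?_⟩
  · simpa [tauPoly_zero] using ws.ne_zero 0
  · simpa [tauPoly_zero] using h.eigens 0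
  · rw [tauPoly_succ, mul_comm, map_mul, Module.End.mul_apply]
    simp

end Chain

section Eigenbasis

variable {K V : Type*} [Field K] [AddCommGroup V] [Module K V]

theorem exists_eigenbasis_of_range_eq_spectrum {ι : Type*} [Fintype ι] [Nonempty ι]
    [FiniteDimensional K V] (hV : Module.finrank K V = Fintype.card ι) {T : Module.End K V}
    {θ : ι → K} (hθ : Function.Injective θ) (h : Set.range θ = spectrum K T) :
    ∃ w : Module.Basis ι K V, ∀ i, T (w i) = θ i • w i := by
  have he : ∀ i, T.HasEigenvalue (θ i) := fun i =>
    Module.End.hasEigenvalue_iff_mem_spectrum.2 (h ▸ Set.mem_range_self i)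
  choose v hv using fun i => (he i).exists_hasEigenvector
  have hli := Module.End.eigenvectors_linearIndependent' T θ hθ v hv
  refine ⟨basisOfLinearIndependentOfCardEqFinrank hli hV.symm, fun i => ?_⟩
  simpa using (hv i).apply_eq_smul

theorem lagrange_eval {ι : Type*} [Fintype ι] [DecidableEq ι] {θ : ι → K}
    (hθ : Function.Injective θ) (i k : ι) :
    (∏ j ∈ Finset.univ.erase i, (C ((θ i - θ j)⁻¹) * (X - C (θ j)))).eval (θ k) =
      if k = i then 1 else 0 := by
  rw [eval_prod]
  split_ifs with h
  · subst h
    refine Finset.prod_eq_one fun j hj => ?_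
    have : θ k - θ j ≠ 0 := sub_ne_zero.2 fun e => Finset.ne_of_mem_erase hj (hθ e).symm
    simp [this]
  · exact Finset.prod_eq_zero (Finset.mem_erase.2 ⟨h, Finset.mem_univ k⟩) (by simp)

theorem Algebra.lsmul_aeval {𝒜 : Type*} [Ring 𝒜] [Algebra K 𝒜] [Module 𝒜 V]
    [IsScalarTower K 𝒜 V] (a : 𝒜) (p : K[X]) :
    Algebra.lsmul K K V (aeval a p) = aeval (Algebra.lsmul K K V a) p :=
  (aeval_algHom_apply (Algebra.lsmul K K V) a p).symm

theorem IsIdempotentOrdering.smul_eq {𝒜 : Type*} [Ring 𝒜] [Algebra K 𝒜] [Module 𝒜 V]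
    [IsScalarTower K 𝒜 V] {d : ℕ} {a : 𝒜} {E : Fin (d + 1) → 𝒜} {θ : Fin (d + 1) → K}
    (h : IsIdempotentOrdering a E θ) {w : Module.Basis (Fin (d + 1)) K V}
    (hw : ∀ i, Algebra.lsmul K K V a (w i) = θ i • w i) (i : Fin (d + 1)) (x : V) :
    E i • x = w.repr x i • w i := by
  refine w.repr.injective (Finsupp.ext fun k => ?_)
  have : E i • x = aeval (Algebra.lsmul K K V a)
      (∏ j ∈ Finset.univ.erase i, (C ((θ i - θ j)⁻¹) * (X - C (θ j)))) x := by
    rw [← Algebra.lsmul_aeval, ← h.2.2 i]; rfl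
  rw [this, Module.Basis.repr_aeval_of_eigen hw, lagrange_eval h.1]
  by_cases hk : k = i
  · simp [hk]
  · simp [hk]

theorem mem_iSup_range_lsmul_iff {𝒜 : Type*} [Ring 𝒜] [Algebra K 𝒜] [Module 𝒜 V]
    [IsScalarTower K 𝒜 V] {ι : Type*} [Fintype ι] {E : ι → 𝒜} {w : Module.Basis ι K V}
    (hE : ∀ i (x : V), E i • x = w.repr x i • w i) (S : Finset ι) (x : V) :
    x ∈ (⨆ j ∈ S, LinearMap.range (Algebra.lsmul K K V (E j))) ↔
      ∀ k, k ∉ S → w.repr x k = 0 := by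
  constructor
  · intro hx k hk
    have : (⨆ j ∈ S, LinearMap.range (Algebra.lsmul K K V (E j))) ≤ LinearMap.ker (w.coord k) := by
      refine iSup₂_le fun j hj => ?_
      rintro _ ⟨y, rfl⟩
      have hjk : j ≠ k := fun e => hk (e ▸ hj)
      simp [hE, hjk]
    simpa using this hx
  · intro h
    rw [← w.sum_repr x]
    refine Submodule.sum_mem _ fun j _ => ?_
    by_cases hj : j ∈ S
    · exact Submodule.mem_iSup_of_mem j (Submodule.mem_iSup_of_mem hj ⟨x, hE j x⟩)
    · rw [h j hj, zero_smul]; exact Submodule.zero_mem _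

end Eigenbasis

section SimpleModule

variable {K 𝒜 V : Type*} [Field K] [Ring 𝒜] [Algebra K 𝒜] [AddCommGroup V] [Module K V]
  [Module 𝒜 V] [IsScalarTower K 𝒜 V] [IsSimpleModule 𝒜 V] {n : Type*} [Fintype n] [DecidableEq n]
  [Nonempty n]

theorem lsmul_injective_of_algEquiv_matrix (f : 𝒜 ≃ₐ[K] Matrix n n K) :
    Function.Injective (Algebra.lsmul K K V : 𝒜 → Module.End K V) := by
  have : Nontrivial V := IsSimpleModule.nontrivial 𝒜 V
  have h := ((Algebra.lsmul K K V : 𝒜 →ₐ[K] Module.End K V).comp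
    f.symm.toAlgHom).toRingHom.injective
  intro a b hab
  exact f.injective (h (by simpa using hab))

theorem finrank_of_algEquiv_matrix (f : 𝒜 ≃ₐ[K] Matrix n n K) :
    FiniteDimensional K V ∧ Module.finrank K V = Fintype.card n := by
  have : Nontrivial V := IsSimpleModule.nontrivial 𝒜 V
  obtain ⟨v, hv⟩ := exists_ne (0 : V)
  obtain ⟨k, hk⟩ : ∃ k, f.symm (Matrix.single k k 1) • v ≠ 0 := by
    by_contra! h
    apply hv
    have h1 : (∑ k, f.symm (Matrix.single k k (1 : K))) • v = 0 := by
      rw [Finset.sum_smul]; exact Finset.sum_eq_zero fun k _ => h k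
    rwa [← map_sum, Matrix.sum_single_one, map_one, one_smul] at h1
  let b : n → V := fun i => f.symm (Matrix.single i k 1) • v
  have hspan : Submodule.span K (Set.range b) = ⊤ := by
    rw [eq_top_iff]
    intro x _
    obtain ⟨a, rfl⟩ := IsSimpleModule.toSpanSingleton_surjective 𝒜 hk x
    have : f a * Matrix.single k k 1 = ∑ i, f a i k • Matrix.single i k (1 : K) := by
      ext p q
      rw [Matrix.sum_apply, Finset.sum_eq_single p]
      · by_cases hq : k = q
        · subst hq; simp
        · simp [hq, Ne.symm hq]
      · intro i _ hi; simp [Matrix.single, hi]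
      · simp
    have e : a • f.symm (Matrix.single k k 1) • v = ∑ i, f a i k • b i := by
      rw [← mul_smul]
      have : a * f.symm (Matrix.single k k 1) = ∑ i, f a i k • f.symm (Matrix.single i k 1) := by
        apply f.injective
        simpa using this
      rw [this, Finset.sum_smul]
      simp [b, smul_assoc]
    rw [LinearMap.toSpanSingleton_apply, e]
    exact Submodule.sum_mem _ fun i _ =>
      Submodule.smul_mem _ _ (Submodule.subset_span (Set.mem_range_self i))
  have hfin : FiniteDimensional K V := by
    refine Module.finite_def.2 ?_
    rw [← hspan]
    exact Submodule.fg_span (Set.finite_range b)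
  refine ⟨hfin, le_antisymm ?_ ?_⟩
  · rw [← finrank_top K V, ← hspan]
    exact finrank_range_le_card b
  · have h := LinearMap.finrank_le_finrank_of_injective
      (f := ((Algebra.lsmul K K V : 𝒜 →ₐ[K] Module.End K V).toLinearMap ∘ₗ
        f.symm.toLinearMap))
      ((lsmul_injective_of_algEquiv_matrix f).comp f.symm.injective)
    rw [Module.finrank_matrix, Module.finrank_linearMap, Module.finrank_self, mul_one] at h
    exact Nat.mul_self_le_mul_self_iff.1 h

theorem lsmul_bijective_of_algEquiv_matrix (f : 𝒜 ≃ₐ[K] Matrix n n K) :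
    Function.Bijective (Algebra.lsmul K K V : 𝒜 → Module.End K V) := by
  obtain ⟨_, hn⟩ := finrank_of_algEquiv_matrix (V := V) f
  have hinj := lsmul_injective_of_algEquiv_matrix (V := V) f
  have : FiniteDimensional K 𝒜 := Module.Finite.equiv f.symm.toLinearEquiv
  refine ⟨hinj, ?_⟩
  have hr : Module.finrank K 𝒜 = Module.finrank K (Module.End K V) := by
    rw [f.toLinearEquiv.finrank_eq, Module.finrank_matrix, Module.finrank_linearMap, hn,
      Module.finrank_self, mul_one]
  exact (LinearMap.injective_iff_surjective_of_finrank_eq_finrank hr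
    (f := (Algebra.lsmul K K V : 𝒜 →ₐ[K] Module.End K V).toLinearMap)).1 hinj

end SimpleModule

namespace LeonardSystem

section Bases

variable {K 𝒜 V : Type*} [Field K] [Ring 𝒜] [Algebra K 𝒜] {d : ℕ}
  [AddCommGroup V] [Module K V] [Module 𝒜 V] [IsScalarTower K 𝒜 V]

theorem isIrreducibleTridiagonal_of_smul_eq
    (hinj : Function.Injective (Algebra.lsmul K K V : 𝒜 → Module.End K V)) {a : 𝒜}
    {E : Fin (d + 1) → 𝒜} {w : Module.Basis (Fin (d + 1)) K V}
    (hE : ∀ i (x : V), E i • x = w.repr x i • w i)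
    (h0 : ∀ i j : Fin (d + 1), 1 < |(i : ℤ) - (j : ℤ)| → E i * a * E j = 0)
    (h1 : ∀ i j : Fin (d + 1), |(i : ℤ) - (j : ℤ)| = 1 → E i * a * E j ≠ 0) :
    IsIrreducibleTridiagonal w (Algebra.lsmul K K V a) := by
  have key : ∀ i j x, (E i * a * E j) • x =
      (w.repr x j * w.repr (Algebra.lsmul K K V a (w j)) i) • w i := by
    intro i j x
    rw [mul_smul, mul_smul, hE j x, hE i, smul_algebra_smul_comm, map_smul, Finsupp.smul_apply,
      smul_eq_mul, Algebra.lsmul_coe]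
  refine ⟨fun i j hij => ?_, fun i j hij hz => h1 i j hij (hinj (LinearMap.ext fun x => ?_))⟩
  · have := key i j (w j)
    rw [h0 i j hij, zero_smul] at this
    simpa [w.ne_zero] using this.symm
  · rw [map_zero, LinearMap.zero_apply, ← zero_smul K (w i), ← mul_zero (w.repr x j), ← hz]
    exact key i j x

theorem exists_eigenbases (Φ : LeonardSystem K 𝒜 d) [FiniteDimensional K V]
    (hV : Module.finrank K V = d + 1)
    (hbij : Function.Bijective (Algebra.lsmul K K V : 𝒜 → Module.End K V)) :
    ∃ w ws : Module.Basis (Fin (d + 1)) K V,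
      IsLeonardEigenbases (Algebra.lsmul K K V Φ.A) (Algebra.lsmul K K V Φ.As) Φ.theta Φ.thetas
        w ws ∧
      (∀ i (x : V), Φ.E i • x = w.repr x i • w i) ∧
        ∀ i (x : V), Φ.Es i • x = ws.repr x i • ws i := by
  have hspec : ∀ a : 𝒜, spectrum K (Algebra.lsmul K K V a) = spectrum K a := fun a =>
    AlgEquiv.spectrum_eq (AlgEquiv.ofBijective (Algebra.lsmul K K V) hbij) a
  have hA : IsIdempotentOrdering Φ.A Φ.E Φ.theta := Φ.hE.choose_spec
  have hAs : IsIdempotentOrdering Φ.As Φ.Es Φ.thetas := Φ.hEs.choose_spec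
  obtain ⟨w, hw⟩ := exists_eigenbasis_of_range_eq_spectrum (by simpa using hV) hA.1
    (hA.2.1.trans (hspec Φ.A).symm)
  obtain ⟨ws, hws⟩ := exists_eigenbasis_of_range_eq_spectrum (by simpa using hV) hAs.1
    (hAs.2.1.trans (hspec Φ.As).symm)
  exact ⟨w, ws, ⟨hA.1, hAs.1, hw, hws,
    isIrreducibleTridiagonal_of_smul_eq hbij.1 (hA.smul_eq hw) Φ.E_As_E_eq_zero Φ.E_As_E_ne_zero,
    isIrreducibleTridiagonal_of_smul_eq hbij.1 (hAs.smul_eq hws) Φ.Es_A_Es_eq_zero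
      Φ.Es_A_Es_ne_zero⟩, hA.smul_eq hw, hAs.smul_eq hws⟩

variable {Φ : LeonardSystem K 𝒜 d} {w ws : Module.Basis (Fin (d + 1)) K V}

theorem mem_splitSpace_iff (hE : ∀ i (x : V), Φ.E i • x = w.repr x i • w i)
    (hEs : ∀ i (x : V), Φ.Es i • x = ws.repr x i • ws i) (i : Fin (d + 1)) (x : V) :
    x ∈ Φ.splitSpace V i ↔
      (∀ k, i < k → ws.repr x k = 0) ∧ ∀ k, k < i → w.repr x k = 0 := by
  rw [splitSpace, Submodule.mem_inf, mem_iSup_range_lsmul_iff hEs, mem_iSup_range_lsmul_iff hE]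
  simp

theorem isSplitBasis_iff_isSplitChain
    (h : IsLeonardEigenbases (Algebra.lsmul K K V Φ.A) (Algebra.lsmul K K V Φ.As) Φ.theta
      Φ.thetas w ws)
    (hE : ∀ i (x : V), Φ.E i • x = w.repr x i • w i)
    (hEs : ∀ i (x : V), Φ.Es i • x = ws.repr x i • ws i) (u : Fin (d + 1) → V) :
    Φ.IsSplitBasis u ↔
      IsSplitChain (Algebra.lsmul K K V Φ.A) (Algebra.lsmul K K V Φ.As) Φ.theta Φ.thetas u := by
  constructor
  · intro hu
    refine ⟨hu.ne_zero 0, ?_, fun k => ?_⟩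
    · refine ws.repr.injective (Finsupp.ext fun k => ?_)
      rw [Module.Basis.repr_apply_of_eigen h.eigens, map_smul, Finsupp.smul_apply, smul_eq_mul]
      rcases eq_or_ne k 0 with rfl | hk
      · rfl
      · rw [((mem_splitSpace_iff hE hEs 0 _).1 (hu.mem 0)).1 k (Fin.pos_of_ne_zero hk), mul_zero,
          mul_zero]
    · rw [← hu.raise k, sub_smul, algebraMap_smul, Algebra.lsmul_coe, add_sub_cancel]
  · intro hu
    refine ⟨fun i => (mem_splitSpace_iff hE hEs i _).2
      ⟨(hu.reprs_triangular h i).1, (hu.repr_triangular h i).1⟩,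
      (hu.linearIndependent h).ne_zero, fun k => ?_⟩
    rw [sub_smul, algebraMap_smul, sub_eq_iff_eq_add']
    exact hu.raise k

theorem firstSplit_spec
    (h : IsLeonardEigenbases (Algebra.lsmul K K V Φ.A) (Algebra.lsmul K K V Φ.As) Φ.theta
      Φ.thetas w ws)
    (hE : ∀ i (x : V), Φ.E i • x = w.repr x i • w i)
    (hEs : ∀ i (x : V), Φ.Es i • x = ws.repr x i • ws i) {u : Fin (d + 1) → V}
    (hu : IsSplitChain (Algebra.lsmul K K V Φ.A) (Algebra.lsmul K K V Φ.As) Φ.theta Φ.thetas u)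
    (k : Fin d) : Φ.firstSplit V k ≠ 0 ∧ Algebra.lsmul K K V Φ.As (u k.succ) =
      Φ.thetas k.succ • u k.succ + Φ.firstSplit V k • u k.castSucc := by
  obtain ⟨c, hc, hAs⟩ := hu.exists_lower h k
  have hmul : Algebra.lsmul K K V ((Φ.A - algebraMap K 𝒜 (Φ.theta k.castSucc)) *
      (Φ.As - algebraMap K 𝒜 (Φ.thetas k.succ))) (u k.succ) = c • u k.succ := by
    rw [map_mul, Module.End.mul_apply, map_sub, map_sub, LinearMap.sub_apply _ _ (u k.succ), hAs,
      AlgHom.commutes, AlgHom.commutes, Module.algebraMap_end_apply, add_sub_cancel_left,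
      LinearMap.sub_apply, map_smul, hu.raise, Module.algebraMap_end_apply, smul_add,
      smul_comm c (Φ.theta k.castSucc), add_sub_cancel_left]
  have hex : ∃ c : K, Φ.splitSpace V k.succ ≤ Module.End.eigenspace
      (Algebra.lsmul K K V ((Φ.A - algebraMap K 𝒜 (Φ.theta k.castSucc)) *
        (Φ.As - algebraMap K 𝒜 (Φ.thetas k.succ)))) c := by
    refine ⟨c, fun x hx => ?_⟩
    obtain ⟨h1, h2⟩ := (mem_splitSpace_iff hE hEs _ _).1 hx
    obtain ⟨r, rfl⟩ := hu.exists_eq_smul h h1 h2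
    rw [Module.End.mem_eigenspace_iff, map_smul, hmul, smul_comm]
  have hmem : u k.succ ∈ Φ.splitSpace V k.succ :=
    ((isSplitBasis_iff_isSplitChain h hE hEs u).2 hu).mem _
  have e := Module.End.mem_eigenspace_iff.1 (Classical.epsilon_spec hex hmem)
  rw [hmul] at e
  have hcφ : c = Φ.firstSplit V k :=
    smul_left_injective K ((hu.linearIndependent h).ne_zero k.succ) e
  rw [← hcφ]
  exact ⟨hc, hAs⟩

theorem trace_lsmul_mul [FiniteDimensional K V] {a b : 𝒜} {v v' : V} {f f' : V →ₗ[K] K}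
    (ha : ∀ x : V, a • x = f x • v) (hb : ∀ x : V, b • x = f' x • v') :
    LinearMap.trace K V (Algebra.lsmul K K V (a * b)) = f' v * f v' := by
  have : Algebra.lsmul K K V (a * b) = LinearMap.smulRight f' (f v' • v) := by
    ext x
    change (a * b) • x = f' x • f v' • v
    rw [mul_smul, ha, hb, map_smul, smul_eq_mul, mul_smul]
  rw [this, LinearMap.trace_smulRight, map_smul, smul_eq_mul, mul_comm]

end Bases

end LeonardSystem

namespace LeonardSystem

section MatrixUnits

variable {K 𝒜 V : Type*} [Field K] [Ring 𝒜] [Algebra K 𝒜] {d : ℕ}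
  [AddCommGroup V] [Module K V] [Module 𝒜 V] [IsScalarTower K 𝒜 V]
  {Φ : LeonardSystem K 𝒜 d} {w ws : Module.Basis (Fin (d + 1)) K V} {u : Fin (d + 1) → V}

theorem aeval_smul (a : 𝒜) (p : K[X]) (x : V) :
    aeval a p • x = aeval (Algebra.lsmul K K V a) p x := by
  rw [← Algebra.lsmul_aeval]; rfl

theorem nu_inv [FiniteDimensional K V] (hE : ∀ i (x : V), Φ.E i • x = w.repr x i • w i)
    (hEs : ∀ i (x : V), Φ.Es i • x = ws.repr x i • ws i) :
    (Φ.nu V)⁻¹ = w.repr (ws 0) 0 * ws.repr (w 0) 0 := by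
  rw [nu, inv_inv, trace_lsmul_mul (f := ws.coord 0) (f' := w.coord 0) (hEs 0) (hE 0)]
  rfl

theorem nu_down_ddown_inv [FiniteDimensional K V]
    (hE : ∀ i (x : V), Φ.E i • x = w.repr x i • w i)
    (hEs : ∀ i (x : V), Φ.Es i • x = ws.repr x i • ws i) :
    (Φ.down.ddown.nu V)⁻¹ = w.repr (ws (Fin.last d)) (Fin.last d) *
      ws.repr (w (Fin.last d)) (Fin.last d) := by
  have h : Φ.down.ddown.Es 0 * Φ.down.ddown.E 0 = Φ.Es (Fin.last d) * Φ.E (Fin.last d) := by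
    simp [down, ddown]
  rw [nu, h, inv_inv, trace_lsmul_mul (f := ws.coord (Fin.last d)) (f' := w.coord (Fin.last d))
    (hEs _) (hE _)]
  rfl

theorem tau_mul_tau_smul [FiniteDimensional K V]
    (h : IsLeonardEigenbases (Algebra.lsmul K K V Φ.A) (Algebra.lsmul K K V Φ.As) Φ.theta
      Φ.thetas w ws)
    (hE : ∀ i (x : V), Φ.E i • x = w.repr x i • w i)
    (hEs : ∀ i (x : V), Φ.Es i • x = ws.repr x i • ws i)
    (hu : IsSplitChain (Algebra.lsmul K K V Φ.A) (Algebra.lsmul K K V Φ.As) Φ.theta Φ.thetas u)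
    (i j k : Fin (d + 1)) :
    ((Φ.nu V / ∏ k : Fin d with k.castSucc < j, Φ.firstSplit V k) •
      (aeval Φ.A (tauPoly Φ.theta i) * Φ.Es 0 * Φ.E 0 * aeval Φ.As (tauPoly Φ.thetas j))) • u k =
      if k = j then u i else 0 := by
  have hφ := firstSplit_spec h hE hEs hu
  have hP : ∏ k : Fin d with k.castSucc < j, Φ.firstSplit V k ≠ 0 :=
    Finset.prod_ne_zero_iff.2 fun k _ => (hφ k).1
  have hν := nu_inv hE hEs
  have hν0 : Φ.nu V ≠ 0 := by
    rw [ne_eq, ← inv_eq_zero, hν]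
    exact mul_ne_zero (h.tri.repr_zero_ne_zero (ws.ne_zero 0) (h.eigens 0))
      (h.tris.repr_zero_ne_zero (w.ne_zero 0) (h.eigen 0))
  obtain ⟨c, hc⟩ : ∃ c : K, u 0 = c • ws 0 := by
    refine ⟨ws.repr (u 0) 0, ?_⟩
    conv_lhs => rw [← ws.sum_repr (u 0)]
    exact Finset.sum_eq_single 0 (fun k _ hk => by rw [hu.reprs_zero_of_ne h hk, zero_smul])
      (by simp)
  have hf := functional_aeval_tauPoly hu.eigen (fun k => (hφ k).2) (f := w.coord 0)
    (fun k hk => (hu.repr_triangular h k).1 0 (Fin.pos_of_ne_zero hk)) j k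
  simp only [Module.Basis.coord_apply] at hf
  rw [smul_assoc, mul_smul, mul_smul, mul_smul, aeval_smul Φ.As, hE, hf, smul_algebra_smul_comm,
    hEs, aeval_smul Φ.A]
  split_ifs with hk
  · have hA : aeval (Algebra.lsmul K K V Φ.A) (tauPoly Φ.theta i) (u 0) = u i := by
      rw [aeval_tauPoly_apply_zero (ψ := fun _ => 1) (fun k => by rw [one_smul]; exact hu.raise k),
        Finset.prod_const_one, one_smul]
    rw [← hA, hc]
    simp only [map_smul, smul_smul, Finsupp.smul_apply, smul_eq_mul]
    congr 1
    have : w.repr (ws 0) 0 * ws.repr (w 0) 0 * Φ.nu V = 1 := by rw [← hν, inv_mul_cancel₀ hν0]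
    field_simp
    linear_combination c * this
  · simp

theorem eta_mul_eta_smul [FiniteDimensional K V]
    (h : IsLeonardEigenbases (Algebra.lsmul K K V Φ.A) (Algebra.lsmul K K V Φ.As) Φ.theta
      Φ.thetas w ws)
    (hE : ∀ i (x : V), Φ.E i • x = w.repr x i • w i)
    (hEs : ∀ i (x : V), Φ.Es i • x = ws.repr x i • ws i)
    (hu : IsSplitChain (Algebra.lsmul K K V Φ.A) (Algebra.lsmul K K V Φ.As) Φ.theta Φ.thetas u)
    (i j k : Fin (d + 1)) :
    ((Φ.down.ddown.nu V / ∏ k : Fin d with i ≤ k.castSucc, Φ.firstSplit V k) •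
      (aeval Φ.As (etaPoly Φ.thetas i.rev) * Φ.E (Fin.last d) * Φ.Es (Fin.last d) *
        aeval Φ.A (etaPoly Φ.theta j.rev))) • u k = if k = j then u i else 0 := by
  have hφ := firstSplit_spec h hE hEs hu
  have hP : ∏ k : Fin d with i ≤ k.castSucc, Φ.firstSplit V k ≠ 0 :=
    Finset.prod_ne_zero_iff.2 fun k _ => (hφ k).1
  have hν := nu_down_ddown_inv hE hEs
  have hν0 : Φ.down.ddown.nu V ≠ 0 := by
    rw [ne_eq, ← inv_eq_zero, hν]
    exact mul_ne_zero (h.tri.repr_last_ne_zero (ws.ne_zero _) (h.eigens _))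
      (h.tris.repr_last_ne_zero (w.ne_zero _) (h.eigen _))
  obtain ⟨c, hc⟩ : ∃ c : K, u (Fin.last d) = c • w (Fin.last d) := by
    refine ⟨w.repr (u (Fin.last d)) (Fin.last d), ?_⟩
    conv_lhs => rw [← w.sum_repr (u (Fin.last d))]
    exact Finset.sum_eq_single _ (fun k _ hk => by
      rw [(hu.repr_triangular h _).1 k (Fin.lt_last_iff_ne_last.2 hk), zero_smul]) (by simp)
  have hf := functional_aeval_tauPoly (T := Algebra.lsmul K K V Φ.A)
    (θ := fun k => Φ.theta k.rev) (u := fun k => u k.rev) (φ := fun _ => 1)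
    (by simpa using hu.apply_last h)
    (fun k => by
      have := hu.raise k.rev
      simpa [Fin.rev_succ, Fin.rev_castSucc] using this)
    (f := ws.coord (Fin.last d))
    (fun k hk => (hu.reprs_triangular h k.rev).1 _ (by
      rw [Fin.lt_last_iff_ne_last]
      intro e
      exact hk (by rw [← Fin.rev_rev k, e, Fin.rev_last]))) j.rev k.rev
  simp only [Module.Basis.coord_apply, Fin.rev_rev, Fin.rev_zero, Fin.rev_inj,
    Finset.prod_const_one, one_mul] at hf
  rw [smul_assoc, mul_smul, mul_smul, mul_smul, aeval_smul Φ.A, hEs,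
    etaPoly_eq_tauPoly Φ.theta, hf,
    smul_algebra_smul_comm, hE, aeval_smul Φ.As, etaPoly_eq_tauPoly Φ.thetas]
  split_ifs with hk
  · have hA : aeval (Algebra.lsmul K K V Φ.As) (tauPoly (fun k => Φ.thetas k.rev) i.rev)
        (u (Fin.last d)) = (∏ k : Fin d with i ≤ k.castSucc, Φ.firstSplit V k) • u i := by
      have e := aeval_tauPoly_apply_zero (T := Algebra.lsmul K K V Φ.As)
        (θ := fun k => Φ.thetas k.rev) (u := fun k => u k.rev)
        (ψ := fun k => Φ.firstSplit V k.rev)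
        (fun k => by simpa [Fin.rev_succ, Fin.rev_castSucc] using (hφ k.rev).2) i.rev
      rw [Fin.rev_zero, Fin.rev_rev] at e
      rw [e]
      congr 1
      refine Finset.prod_bij' (fun k _ => k.rev) (fun k _ => k.rev) ?_ ?_ ?_ ?_ ?_
      · intro k hk
        simp only [Finset.mem_filter, Finset.mem_univ, true_and, Fin.lt_def, Fin.le_def,
          Fin.val_rev, Fin.val_castSucc] at hk ⊢
        omega
      · intro k hk
        simp only [Finset.mem_filter, Finset.mem_univ, true_and, Fin.lt_def, Fin.le_def,
          Fin.val_rev, Fin.val_castSucc] at hk ⊢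
        omega
      all_goals simp
    have hui : u i = (∏ k : Fin d with i ≤ k.castSucc, Φ.firstSplit V k)⁻¹ •
        aeval (Algebra.lsmul K K V Φ.As) (tauPoly (fun k => Φ.thetas k.rev) i.rev)
          (u (Fin.last d)) := by rw [hA, inv_smul_smul₀ hP]
    rw [hui, hc]
    simp only [map_smul, smul_smul, Finsupp.smul_apply, smul_eq_mul]
    congr 1
    have : w.repr (ws (Fin.last d)) (Fin.last d) * ws.repr (w (Fin.last d)) (Fin.last d) *
        Φ.down.ddown.nu V = 1 := by rw [← hν, inv_mul_cancel₀ hν0]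
    field_simp
    linear_combination c * this
  · simp

end MatrixUnits

end LeonardSystem

theorem represents_single_iff {K 𝒜 V : Type*} [Field K] [Ring 𝒜] [AddCommGroup V] [Module K V]
    [Module 𝒜 V] {d : ℕ} {i j : Fin (d + 1)} {x : 𝒜} {u : Fin (d + 1) → V} :
    Represents (Matrix.single i j (1 : K)) x u ↔ ∀ k, x • u k = if k = j then u i else 0 := by
  refine forall_congr' fun k => ?_
  have : ∑ l, Matrix.single i j (1 : K) l k • u l = if k = j then u i else 0 := by
    rw [Finset.sum_eq_single i]
    · by_cases hk : k = j
      · simp [hk]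
      · simp [hk, Ne.symm hk, Matrix.single]
    · intro l _ hl
      simp [Matrix.single, hl.symm]
    · simp
  rw [this]

theorem theorem6p5 {K 𝒜 V : Type*} [Field K] [Ring 𝒜] [Algebra K 𝒜] (d : ℕ)
    (h𝒜 : Nonempty (𝒜 ≃ₐ[K] Matrix (Fin (d + 1)) (Fin (d + 1)) K))
    [AddCommGroup V] [Module K V] [Module 𝒜 V] [IsScalarTower K 𝒜 V] [IsSimpleModule 𝒜 V]
    (Φ : LeonardSystem K 𝒜 d) :
    (∃ u : Fin (d + 1) → V, Φ.IsSplitBasis u) ∧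
    ∀ u : Fin (d + 1) → V, Φ.IsSplitBasis u →
      LinearIndependent K u ∧ Submodule.span K (Set.range u) = ⊤ ∧
      ∀ i j : Fin (d + 1),
        (∃! Δ : 𝒜, Represents (Matrix.single i j (1 : K)) Δ u) ∧
        ∀ Δ : 𝒜, Represents (Matrix.single i j (1 : K)) Δ u →
          Δ = (Φ.nu V / ∏ k : Fin d with k.castSucc < j, Φ.firstSplit V k) •
              (aeval Φ.A (tauPoly Φ.theta i) * Φ.Es 0 * Φ.E 0 *
                aeval Φ.As (tauPoly Φ.thetas j)) ∧
          Δ = (Φ.down.ddown.nu V / ∏ k : Fin d with i ≤ k.castSucc, Φ.firstSplit V k) •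
              (aeval Φ.As (etaPoly Φ.thetas i.rev) * Φ.E (Fin.last d) * Φ.Es (Fin.last d) *
                aeval Φ.A (etaPoly Φ.theta j.rev)) := by
  obtain ⟨f⟩ := h𝒜
  obtain ⟨_, hV⟩ := finrank_of_algEquiv_matrix (V := V) f
  rw [Fintype.card_fin] at hV
  have hbij := lsmul_bijective_of_algEquiv_matrix (V := V) f
  obtain ⟨w, ws, h, hE, hEs⟩ := Φ.exists_eigenbases hV hbij
  constructor
  · obtain ⟨u, hu⟩ := exists_isSplitChain h
    exact ⟨u, (LeonardSystem.isSplitBasis_iff_isSplitChain h hE hEs u).2 hu⟩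
  intro u hu
  rw [LeonardSystem.isSplitBasis_iff_isSplitChain h hE hEs] at hu
  have hli := hu.linearIndependent h
  have hspan := hu.span_eq_top h
  have hext : ∀ x y : 𝒜, (∀ k, x • u k = y • u k) → x = y := fun x y hxy =>
    hbij.1 (LinearMap.ext_on_range hspan hxy)
  refine ⟨hli, hspan, fun i j => ⟨?_, fun Δ hΔ => ?_⟩⟩
  · obtain ⟨Δ, hΔ⟩ := hbij.2 ((Module.Basis.mk hli hspan.ge).constr K
      fun k => if k = j then u i else 0)
    have hΔu : ∀ k, Δ • u k = if k = j then u i else 0 := fun k => by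
      have e := (Module.Basis.mk hli hspan.ge).constr_basis K (fun k => if k = j then u i else 0) k
      rwa [← hΔ, Module.Basis.mk_apply] at e
    refine ⟨Δ, represents_single_iff.2 hΔu, fun x hx => hext _ _ fun k => ?_⟩
    rw [represents_single_iff.1 hx, hΔu]
  · rw [represents_single_iff] at hΔ
    exact ⟨hext _ _ fun k => (hΔ k).trans (Φ.tau_mul_tau_smul h hE hEs hu i j k).symm,
      hext _ _ fun k => (hΔ k).trans (Φ.eta_mul_eta_smul h hE hEs hu i j k).symm⟩
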